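/- Let $(\Omega,\mathcal P)$ be a probability space and let $0<A<B<1$. Let $(a_n,b_n)_{n\ge 1}$ be i.i.d. random pairs with values in $\{(x,y)\in[0,1]^2: A\le \min(x,y),\ x+y\le B\}$, and let $(p_n)_{n\ge1}$ be i.i.d. random variables with values in $[0,1]$, the sequence $(p_n)$ being independent of the sequence $((a_n,b_n))$, such that $\mathbb E(p_n^{-t})<\infty$ and $\mathbb E((1-p_n)^{-t})<\infty$ for some $t>0$ (with $0^{-t}=\infty$). For each $\omega$, start from the interval $[0,1]$ (step $0$); each interval $I$ of step $n-1$ has two children of step $n$: the left child is the closed subinterval of $I$ with the same left endpoint and length $a_n(\omega)|I|$, the right child is the closed subinterval of $I$ with the same right endpoint and length $b_n(\omega)|I|$. Let $\mu_\omega$ be the Borel probability measure on $[0,1]$ such that, for every interval $I$ of step $n-1$ ($n\ge 1$), the left child of $I$ has mass $p_n(\omega)\mu_\omega(I)$ and the right child has mass $(1-p_n(\omega))\mu_\omega(I)$. For $\theta\ge0$ set $$G(\theta)=\frac{\mathbb E(Y(\theta))}{\mathbb E(Z(\theta))},\qquad (Y(\theta),Z(\theta))=\begin{cases}(\log p_1,\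 \log a_1)&\text{if } p_1\le \dfrac{a_1^\theta}{a_1^\theta+b_1^\theta},\\[2mm] (\log(1-p_1),\ \log b_1)&\text{otherwise.}\end{cases}$$ A dimension function is a map $\Phi:(0,1)\to[0,\infty)$ such that $t^{1+\Phi(t)}$ decreases (in the weak sense) to $0$ as $t$ decreases to $0$. It is large if, for all $t$ close to $0$, $\Phi(t)=H(t)\,\dfrac{\log|\log t|}{|\log t|}$ with $H(t)\to\infty$ as $t\to0^+$. The upper $\Phi$-dimension $\overline{\dim}_\Phi\mu\in[-\infty,\infty]$ of a Borel probability measure $\mu$ on $\mathbb R$ is the infimum of all $d\in\mathbb R$ for which there are $C_1\in(0,1)$ and $C_2>0$ such that $$\frac{\mu(B(x,R))}{\mu(B(x,r))}\le C_2\left(\frac Rr\right)^d\qquad\text{for all } 0<r<R^{1+\Phi(R)}\le R\le C_1 \text{ and all } x\in\operatorname{supp}\mu,$$ where $B(x,s)$ is the open ball of radius $s$ centred at $x$. Suppose that $\alpha\ge0$ satisfies $G(\alpha)=\alpha$ and $G(\psi)<\psi$ for all $\psi>\alpha$. Then there is a measurable set $\Gamma\subseteq\Omega$ with $\mathcal P(\Gamma)=1$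 such that $\overline{\dim}_\Phi\mu_\omega=\alpha$ for every large dimension function $\Phi$ and every $\omega\in\Gamma$. -/

import Mathlib

open MeasureTheory ProbabilityTheory Filter Topology Set

noncomputable section

namespace RandomMoran

/-! ### Dimension functions and the upper `Φ`-dimension of a measure -/

/-- A dimension function: a map `Φ : (0,1) → [0,∞)` such that `t ^ (1 + Φ t)` decreases to `0`
as `t` decreases to `0`. Only the values of `Φ` on `(0,1)` matter. -/
structure IsDimensionFunction (Φ : ℝ → ℝ) : Prop where
  nonneg : ∀ t ∈ Ioo (0 : ℝ) 1, 0 ≤ Φ t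
  monotoneOn : MonotoneOn (fun t : ℝ => t ^ (1 + Φ t)) (Ioo (0 : ℝ) 1)
  tendsto_zero : Tendsto (fun t : ℝ => t ^ (1 + Φ t)) (𝓝[>] 0) (𝓝 0)

/-- `Φ` is large: `Φ t = H t * log |log t| / |log t|` near `0`, where `H t → ∞` as `t → 0⁺`. -/
def IsLarge (Φ : ℝ → ℝ) : Prop :=
  ∃ H : ℝ → ℝ, Tendsto H (𝓝[>] 0) atTop ∧
    ∀ᶠ t in 𝓝[>] (0 : ℝ), Φ t = H t * (Real.log |Real.log t| / |Real.log t|)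

/-- The set of exponents `d` admissible in the definition of the upper `Φ`-dimension. The bound
`C₁ < 1` only says that `Φ` is evaluated inside its domain `(0,1)`. -/
def upperExponents {X : Type*} [PseudoMetricSpace X] [MeasurableSpace X]
    (Φ : ℝ → ℝ) (μ : Measure X) : Set ℝ :=
  {d : ℝ | ∃ C₁ C₂ : ℝ, 0 < C₁ ∧ C₁ < 1 ∧ 0 < C₂ ∧
    ∀ r R : ℝ, 0 < r → r < R ^ (1 + Φ R) → R ^ (1 + Φ R) ≤ R → 0 < R → R ≤ C₁ →
      ∀ x ∈ μ.support,
        μ (Metric.ball x R) / μ (Metric.ball x r) ≤ ENNReal.ofReal (C₂ * (R / r) ^ d)}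

/-- The upper `Φ`-dimension of `μ`, the infimum of the admissible exponents, taken in `[-∞, ∞]`
(so that it is `∞` when there is no admissible exponent). -/
def upperPhiDim {X : Type*} [PseudoMetricSpace X] [MeasurableSpace X]
    (Φ : ℝ → ℝ) (μ : Measure X) : EReal :=
  sInf ((fun d : ℝ => (d : EReal)) '' upperExponents Φ μ)

/-! ### Moran intervals and the Moran measure for given sequences of ratios and probabilities

Levels are counted from `0`: the children of an interval of step `n` are formed with `a n`, `b n`
and `p n`. A branch is a sequence `v : ℕ → Bool`; at step `n` it goes to the left child if
`v n = false` and to the right child if `v n = true`. -/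

/-- Length of the Moran interval of step `n` along the branch `v`. -/
def moranLength (a b : ℕ → ℝ) (v : ℕ → Bool) : ℕ → ℝ
  | 0 => 1
  | n + 1 => (if v n then b n else a n) * moranLength a b v n

/-- Left endpoint of the Moran interval of step `n` along the branch `v`: a left child keeps the
left endpoint of its parent, a right child keeps the right endpoint of its parent. -/
def moranLeft (a b : ℕ → ℝ) (v : ℕ → Bool) : ℕ → ℝ
  | 0 => 0
  | n + 1 => moranLeft a b v n + (if v n then (1 - b n) * moranLength a b v n else 0)

/-- The Moran interval of step `n` along the branch `v`; it depends only on `v 0, …, v (n - 1)`. -/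
def moranInterval (a b : ℕ → ℝ) (v : ℕ → Bool) (n : ℕ) : Set ℝ :=
  Icc (moranLeft a b v n) (moranLeft a b v n + moranLength a b v n)

/-- The point `⋂ n, moranInterval a b v n`, as the supremum of the left endpoints. -/
def moranPoint (a b : ℕ → ℝ) (v : ℕ → Bool) : ℝ := ⨆ n, moranLeft a b v n

/-- The Moran measure: the image, under `v ↦ moranPoint a b v`, of the product measure on branches
that goes left at level `n` with probability `p n` and right with probability `1 - p n`. By
`moranMeasure_Icc`, `moranMeasure_left` and `moranMeasure_right` below it has mass one on `[0,1]`
and gives the left and the right child of an interval `I` of step `n` the mass `p n * μ I` and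
`(1 - p n) * μ I`; this determines it. -/
def moranMeasure (a b : ℕ → ℝ) (p : ℕ → unitInterval) : Measure ℝ :=
  (Measure.infinitePi fun n => bernoulliMeasure false true (p n)).map (moranPoint a b)

lemma measurable_moranLength (a b : ℕ → ℝ) (n : ℕ) :
    Measurable fun v : ℕ → Bool => moranLength a b v n := by
  induction n with
  | zero => exact measurable_const
  | succ n ih =>
    have h : Measurable fun v : ℕ → Bool => if v n then b n else a n :=
      (measurable_of_finite fun c : Bool => if c then b n else a n).comp (measurable_pi_apply n)
    exact h.mul ih

lemma measurable_moranLeft (a b : ℕ → ℝ) (n : ℕ) :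
    Measurable fun v : ℕ → Bool => moranLeft a b v n := by
  induction n with
  | zero => exact measurable_const
  | succ n ih =>
    have h : Measurable fun v : ℕ → Bool => if v n then (1 - b n) else 0 :=
      (measurable_of_finite fun c : Bool => if c then (1 - b n) else 0).comp
        (measurable_pi_apply n)
    have h2 : (fun v : ℕ → Bool => moranLeft a b v (n + 1)) =
        fun v => moranLeft a b v n + (if v n then (1 - b n) else 0) * moranLength a b v n := by
      funext v
      simp [moranLeft]
    rw [h2]
    exact ih.add (h.mul (measurable_moranLength a b n))

lemma measurable_moranPoint (a b : ℕ → ℝ) : Measurable (moranPoint a b) :=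
  Measurable.iSup fun n => measurable_moranLeft a b n

section Rule

variable {a b : ℕ → ℝ}

lemma moranLength_pos (ha : ∀ n, 0 < a n) (hb : ∀ n, 0 < b n) (v : ℕ → Bool) (n : ℕ) :
    0 < moranLength a b v n := by
  induction n with
  | zero => simp [moranLength]
  | succ n ih =>
    have h : 0 < (if v n then b n else a n) := by
      split_ifs
      · exact hb n
      · exact ha n
    exact mul_pos h ih

lemma moranInterval_succ_subset (ha : ∀ n, 0 < a n) (hb : ∀ n, 0 < b n)
    (hab : ∀ n, a n + b n < 1) (v : ℕ → Bool) (n : ℕ) :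
    moranInterval a b v (n + 1) ⊆ moranInterval a b v n := by
  have hl := moranLength_pos ha hb v n
  have h1 := ha n
  have h2 := hb n
  have h3 := hab n
  apply Icc_subset_Icc
  · simp only [moranLeft]
    split_ifs <;> nlinarith
  · simp only [moranLeft, moranLength]
    split_ifs <;> nlinarith

lemma moranInterval_antitone (ha : ∀ n, 0 < a n) (hb : ∀ n, 0 < b n)
    (hab : ∀ n, a n + b n < 1) (v : ℕ → Bool) : Antitone (moranInterval a b v) :=
  antitone_nat_of_succ_le (moranInterval_succ_subset ha hb hab v)

lemma moranPoint_mem (ha : ∀ n, 0 < a n) (hb : ∀ n, 0 < b n)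
    (hab : ∀ n, a n + b n < 1) (v : ℕ → Bool) (n : ℕ) :
    moranPoint a b v ∈ moranInterval a b v n := by
  have hanti := moranInterval_antitone ha hb hab v
  have hmem : ∀ m, moranLeft a b v m ∈ moranInterval a b v m := fun m =>
    left_mem_Icc.2 (by linarith [moranLength_pos ha hb v m])
  have hup : ∀ m, moranLeft a b v m ≤ moranLeft a b v n + moranLength a b v n := by
    intro m
    have hle : moranLeft a b v m ≤ moranLeft a b v (max m n) :=
      (hanti (le_max_left m n) (hmem _)).1
    exact hle.trans (hanti (le_max_right m n) (hmem _)).2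
  exact ⟨le_ciSup (f := moranLeft a b v) ⟨_, by rintro _ ⟨m, rfl⟩; exact hup m⟩ n, ciSup_le hup⟩

lemma moranLength_congr {v w : ℕ → Bool} {n : ℕ} (h : ∀ i < n, w i = v i) :
    moranLength a b w n = moranLength a b v n := by
  induction n with
  | zero => rfl
  | succ n ih =>
    simp only [moranLength, h n (Nat.lt_succ_self n),
      ih fun i hi => h i (hi.trans (Nat.lt_succ_self n))]

lemma moranLeft_congr {v w : ℕ → Bool} {n : ℕ} (h : ∀ i < n, w i = v i) :
    moranLeft a b w n = moranLeft a b v n := by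
  induction n with
  | zero => rfl
  | succ n ih =>
    have h' : ∀ i < n, w i = v i := fun i hi => h i (hi.trans (Nat.lt_succ_self n))
    simp only [moranLeft, h n (Nat.lt_succ_self n), ih h', moranLength_congr h']

lemma moranPoint_mem_iff (ha : ∀ n, 0 < a n) (hb : ∀ n, 0 < b n)
    (hab : ∀ n, a n + b n < 1) (v w : ℕ → Bool) (n : ℕ) :
    moranPoint a b w ∈ moranInterval a b v n ↔ ∀ i < n, w i = v i := by
  constructor
  · intro h
    induction n with
    | zero => intro i hi; exact absurd hi (Nat.not_lt_zero i)
    | succ n ih =>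
      have hv := ih (moranInterval_succ_subset ha hb hab v n h)
      intro i hi
      rcases Nat.lt_succ_iff_lt_or_eq.1 hi with hi | rfl
      · exact hv i hi
      · have hw := moranPoint_mem ha hb hab w (i + 1)
        have hl := moranLength_pos ha hb v i
        have h3 := hab i
        simp only [moranInterval, moranLeft, moranLength, mem_Icc, moranLeft_congr hv,
          moranLength_congr hv] at h hw
        cases h1 : v i <;> cases h2 : w i <;> simp only [h1, h2] at h hw ⊢
        all_goals
          exfalso
          simp at h hw
          nlinarith [h.1, h.2, hw.1, hw.2]
  · intro h
    have hw := moranPoint_mem ha hb hab w n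
    rwa [moranInterval, moranLeft_congr h, moranLength_congr h] at hw

lemma moranMeasure_moranInterval (ha : ∀ n, 0 < a n) (hb : ∀ n, 0 < b n)
    (hab : ∀ n, a n + b n < 1) (p : ℕ → unitInterval) (v : ℕ → Bool) (n : ℕ) :
    moranMeasure a b p (moranInterval a b v n) =
      ∏ i ∈ Finset.range n, bernoulliMeasure false true (p i) {v i} := by
  have hset : moranPoint a b ⁻¹' moranInterval a b v n =
      Set.pi (Finset.range n : Finset ℕ) fun i => {v i} := by
    ext w
    simp [moranPoint_mem_iff ha hb hab]
  rw [moranMeasure, Measure.map_apply (measurable_moranPoint a b)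
    (by exact measurableSet_Icc : MeasurableSet (moranInterval a b v n)), hset,
    Measure.infinitePi_pi _ fun i _ => measurableSet_singleton _]

/-- The Moran measure gives mass one to `[0,1]`. -/
theorem moranMeasure_Icc (ha : ∀ n, 0 < a n) (hb : ∀ n, 0 < b n)
    (hab : ∀ n, a n + b n < 1) (p : ℕ → unitInterval) :
    moranMeasure a b p (Icc 0 1) = 1 := by
  have h := moranMeasure_moranInterval ha hb hab p (fun _ => false) 0
  simpa [moranInterval, moranLeft, moranLength] using h

/-- The Moran measure has total mass one. -/
instance isProbabilityMeasure_moranMeasure (a b : ℕ → ℝ) (p : ℕ → unitInterval) : IsProbabilityMeasure (moranMeasure a b p) :=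
  Measure.isProbabilityMeasure_map (measurable_moranPoint a b).aemeasurable

/-- The left child of an interval of step `n` gets the fraction `p n` of its mass. -/
theorem moranMeasure_left (ha : ∀ n, 0 < a n) (hb : ∀ n, 0 < b n)
    (hab : ∀ n, a n + b n < 1) (p : ℕ → unitInterval) (v : ℕ → Bool) (n : ℕ)
    (hv : v n = false) :
    moranMeasure a b p (moranInterval a b v (n + 1)) =
      ENNReal.ofReal (p n) * moranMeasure a b p (moranInterval a b v n) := by
  rw [moranMeasure_moranInterval ha hb hab, moranMeasure_moranInterval ha hb hab,
    Finset.prod_range_succ, mul_comm, hv,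
    bernoulliMeasure_apply_of_mem_of_notMem (p n) (measurableSet_singleton _) rfl (by simp)]
  congr 1
  rw [ENNReal.ofReal]
  congr 1
  exact (Real.toNNReal_of_nonneg _).symm

/-- The right child of an interval of step `n` gets the fraction `1 - p n` of its mass. -/
theorem moranMeasure_right (ha : ∀ n, 0 < a n) (hb : ∀ n, 0 < b n)
    (hab : ∀ n, a n + b n < 1) (p : ℕ → unitInterval) (v : ℕ → Bool) (n : ℕ)
    (hv : v n = true) :
    moranMeasure a b p (moranInterval a b v (n + 1)) =
      ENNReal.ofReal (1 - p n) * moranMeasure a b p (moranInterval a b v n) := by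
  rw [moranMeasure_moranInterval ha hb hab, moranMeasure_moranInterval ha hb hab,
    Finset.prod_range_succ, mul_comm, hv,
    bernoulliMeasure_apply_of_notMem_of_mem (p n) (measurableSet_singleton _) (by simp) rfl]
  congr 1
  rw [← unitInterval.coe_symm_eq, ENNReal.ofReal]
  congr 1
  exact (Real.toNNReal_of_nonneg _).symm

end Rule

/-! ### The random model -/

/-- The standing assumptions on the random ratios `a n`, `b n` and probabilities `p n`
on the probability space `(Ω, P)`:
* `0 < A < B < 1`, and `(a n, b n)` takes values in `{(x, y) : A ≤ min x y, x + y ≤ B}` (so that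
  `𝔼 (a n ^ (-t))` and `𝔼 (b n ^ (-t))` are automatically finite);
* the pairs `(a n, b n)` are independent and identically distributed;
* the `p n` are independent and identically distributed in `[0,1]`, and the sequence `p` is
  independent of the sequence `(a, b)`;
* `𝔼 (p n ^ (-t)) < ∞` and `𝔼 ((1 - p n) ^ (-t)) < ∞` for some `t > 0` (where `0 ^ (-t) = ∞`). -/
structure IsRandomMoranModel {Ω : Type*} [MeasurableSpace Ω] (P : Measure Ω) (A B : ℝ)
    (a b : ℕ → Ω → ℝ) (p : ℕ → Ω → unitInterval) : Prop where
  A_pos : 0 < A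
  A_lt_B : A < B
  B_lt_one : B < 1
  measurable_a : ∀ n, Measurable (a n)
  measurable_b : ∀ n, Measurable (b n)
  measurable_p : ∀ n, Measurable (p n)
  le_min : ∀ n ω, A ≤ min (a n ω) (b n ω)
  add_le : ∀ n ω, a n ω + b n ω ≤ B
  indep_ab : iIndepFun (fun n ω => (a n ω, b n ω)) P
  ident_ab : ∀ n, IdentDistrib (fun ω => (a n ω, b n ω)) (fun ω => (a 0 ω, b 0 ω)) P P
  indep_p : iIndepFun p P
  ident_p : ∀ n, IdentDistrib (p n) (p 0) P P
  indep_ab_p : IndepFun (fun ω n => (a n ω, b n ω)) (fun ω n => p n ω) P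
  moment_p : ∃ t : ℝ, 0 < t ∧ ∀ n,
    ∫⁻ ω, ENNReal.ofReal (p n ω : ℝ) ^ (-t) ∂P < ⊤ ∧
    ∫⁻ ω, ENNReal.ofReal (1 - (p n ω : ℝ)) ^ (-t) ∂P < ⊤

/-- The random measure `μ_ω`. -/
def randomMoranMeasure {Ω : Type*} (a b : ℕ → Ω → ℝ) (p : ℕ → Ω → unitInterval) (ω : Ω) :
    Measure ℝ :=
  moranMeasure (fun n => a n ω) (fun n => b n ω) (fun n => p n ω)

/-- `Y(θ)` for the values `x`, `y`, `q` of `a n`, `b n`, `p n`. -/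
def Yval (θ x y q : ℝ) : ℝ :=
  if q ≤ x ^ θ / (x ^ θ + y ^ θ) then Real.log q else Real.log (1 - q)

/-- `Z(θ)` for the values `x`, `y`, `q` of `a n`, `b n`, `p n`. -/
def Zval (θ x y q : ℝ) : ℝ :=
  if q ≤ x ^ θ / (x ^ θ + y ^ θ) then Real.log x else Real.log y

/-- `G(θ) = 𝔼(Y₁(θ)) / 𝔼(Z₁(θ))`; the first level has index `0` here. -/
def G {Ω : Type*} [MeasurableSpace Ω] (P : Measure Ω) (a b : ℕ → Ω → ℝ)
    (p : ℕ → Ω → unitInterval) (θ : ℝ) : ℝ :=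
  (∫ ω, Yval θ (a 0 ω) (b 0 ω) (p 0 ω) ∂P) / ∫ ω, Zval θ (a 0 ω) (b 0 ω) (p 0 ω) ∂P

end RandomMoran

end

/-! For a fixed exponent `θ`, the exponential of `excess` is the larger of the two quotients ratio^θ
/ weight. Multiplying over levels, the mass quotient of two nested intervals is at most the `θ`-th
power of their length quotient times the exponential of the sum of the excesses over the levels
between them (`branchMass_mul_rpow_le`). Starting from step 0, the branch that always takes
`bestChild` gives equality: its mass is the smallest relative to length^θ. The mean excess is `(θ -
G θ) * 𝔼 Z` with `𝔼 Z < 0`, so it is negative for `θ > α` and zero at `θ = α`.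

Upper bound. For `θ > α`, Chernoff's inequality makes a positive sum over a window of `n` levels
exponentially unlikely in `n`, and Borel–Cantelli covers all starting levels `N ≤ τ ^ (-n)` at once
(`ae_sum_window_nonpos`). A scale `R` corresponds to a starting level of order at most `|log R|`,
and largeness of `Φ` makes every window longer than any prescribed multiple of `log |log R|`, so all
relevant windows are covered (`mem_upperExponents`).

Lower bound. At `θ = α` the law of large numbers makes the excess sums `o(n)`. With `R` fixed and `r
→ 0` around the point of the best branch, an exponent `d < α` would bound a fixed positive mass by
an exponentially small quantity (`le_of_mem_upperExponents`).

The almost sure events involve only `α` and the exponents `α + 1 / (k + 1)`, never `Φ`; hence one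
set serves all `Φ`. -/

noncomputable section

namespace RandomMoran

/-! ### One-step comparison of ratios and weights -/

/-- The weight given to a child: `q` for the left child, `1 - q` for the right child. -/
def branchWeight (q : ℝ) (c : Bool) : ℝ := if c then 1 - q else q

/-- The contraction ratio of a child: `x` for the left child, `y` for the right child. -/
def branchRatio (x y : ℝ) (c : Bool) : ℝ := if c then y else x

/-- The larger of `θ log x - log q` and `θ log y - log (1 - q)`. -/
def excess (θ x y q : ℝ) : ℝ := θ * Zval θ x y q - Yval θ x y q

/-- The child that realizes `excess`. -/
def bestChild (θ x y q : ℝ) : Bool := !decide (q ≤ x ^ θ / (x ^ θ + y ^ θ))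

lemma branchWeight_pos {q : ℝ} (hq : q ∈ Ioo (0 : ℝ) 1) (c : Bool) : 0 < branchWeight q c := by
  cases c
  · exact hq.1
  · simpa [branchWeight] using hq.2

lemma exp_excess_mul_branchWeight {θ x y q : ℝ} (hx : 0 < x) (hy : 0 < y)
    (hq : q ∈ Ioo (0 : ℝ) 1) :
    Real.exp (excess θ x y q) * branchWeight q (bestChild θ x y q) =
      branchRatio x y (bestChild θ x y q) ^ θ := by
  have hq' : 0 < 1 - q := by linarith [hq.2]
  by_cases h : q ≤ x ^ θ / (x ^ θ + y ^ θ)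
  · simp only [excess, Zval, Yval, bestChild, branchWeight, branchRatio, h]
    simp only [if_true, decide_true, Bool.not_true, Bool.false_eq_true, if_false]
    rw [Real.exp_sub, Real.exp_log hq.1, div_mul_cancel₀ _ hq.1.ne', Real.rpow_def_of_pos hx,
      mul_comm]
  · simp only [excess, Zval, Yval, bestChild, branchWeight, branchRatio, h]
    simp only [if_false, decide_false, Bool.not_false, if_true]
    rw [Real.exp_sub, Real.exp_log hq', div_mul_cancel₀ _ hq'.ne', Real.rpow_def_of_pos hy,
      mul_comm]

/-- With denominators cleared, the threshold in `Yval` and `Zval` reads `q * y ^ θ ≤ (1 - q) * x ^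
θ`: it selects the child with the larger ratio^θ / weight. -/
lemma branchRatio_rpow_le {θ x y q : ℝ} (hx : 0 < x) (hy : 0 < y)
    (hq : q ∈ Ioo (0 : ℝ) 1) (c : Bool) :
    branchRatio x y c ^ θ ≤ Real.exp (excess θ x y q) * branchWeight q c := by
  have hq' : 0 < 1 - q := by linarith [hq.2]
  have hq0 := hq.1
  have hX : 0 < x ^ θ := Real.rpow_pos_of_pos hx θ
  have hY : 0 < y ^ θ := Real.rpow_pos_of_pos hy θ
  have hbest := exp_excess_mul_branchWeight (θ := θ) hx hy hq
  by_cases h : q ≤ x ^ θ / (x ^ θ + y ^ θ)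
  · have hc : bestChild θ x y q = false := by simp [bestChild, h]
    rw [hc] at hbest
    rw [le_div_iff₀ (by positivity)] at h
    simp only [branchWeight, branchRatio, Bool.false_eq_true, if_false] at hbest
    cases c
    · simp [branchWeight, branchRatio, hbest]
    · simp only [branchWeight, branchRatio, if_true]
      refine le_of_mul_le_mul_left ?_ hq0
      calc q * y ^ θ ≤ (1 - q) * x ^ θ := by linarith
        _ = _ := by rw [← hbest]; ring
  · have hc : bestChild θ x y q = true := by simp [bestChild, h]
    rw [hc] at hbest
    rw [not_le, div_lt_iff₀ (by positivity)] at h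
    simp only [branchWeight, branchRatio, if_true] at hbest
    cases c
    · simp only [branchWeight, branchRatio, Bool.false_eq_true, if_false]
      refine le_of_mul_le_mul_left ?_ hq'
      calc (1 - q) * x ^ θ ≤ q * y ^ θ := by linarith
        _ = _ := by rw [← hbest]; ring
    · simp [branchWeight, branchRatio, hbest]

/-! ### Lengths, masses and balls in a Moran construction with bounded ratios -/

lemma moranLength_succ (a b : ℕ → ℝ) (v : ℕ → Bool) (n : ℕ) :
    moranLength a b v (n + 1) = branchRatio (a n) (b n) (v n) * moranLength a b v n := rfl

/-- The mass of the Moran interval of step `n` along `v`. -/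
def branchMass (p : ℕ → unitInterval) (v : ℕ → Bool) (n : ℕ) : ℝ :=
  ∏ i ∈ Finset.range n, branchWeight (p i) (v i)

lemma branchMass_succ (p : ℕ → unitInterval) (v : ℕ → Bool) (n : ℕ) :
    branchMass p v (n + 1) = branchMass p v n * branchWeight (p n) (v n) :=
  Finset.prod_range_succ _ _

lemma branchMass_pos {p : ℕ → unitInterval} (hp : ∀ n, (p n : ℝ) ∈ Ioo (0 : ℝ) 1)
    (v : ℕ → Bool) (n : ℕ) : 0 < branchMass p v n :=
  Finset.prod_pos fun i _ => branchWeight_pos (hp i) (v i)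

/-- Bounds on the ratios of a Moran construction. -/
structure IsRatioPair (A B : ℝ) (a b : ℕ → ℝ) : Prop where
  A_pos : 0 < A
  A_lt_B : A < B
  B_lt_one : B < 1
  le_a : ∀ n, A ≤ a n
  le_b : ∀ n, A ≤ b n
  add_le : ∀ n, a n + b n ≤ B

namespace IsRatioPair

variable {A B : ℝ} {a b : ℕ → ℝ}

lemma B_pos (h : IsRatioPair A B a b) : 0 < B := h.A_pos.trans h.A_lt_B
lemma a_pos (h : IsRatioPair A B a b) (n : ℕ) : 0 < a n := h.A_pos.trans_le (h.le_a n)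
lemma b_pos (h : IsRatioPair A B a b) (n : ℕ) : 0 < b n := h.A_pos.trans_le (h.le_b n)
lemma add_lt (h : IsRatioPair A B a b) (n : ℕ) : a n + b n < 1 := (h.add_le n).trans_lt h.B_lt_one

lemma length_pos (h : IsRatioPair A B a b) (v : ℕ → Bool) (n : ℕ) : 0 < moranLength a b v n :=
  moranLength_pos h.a_pos h.b_pos v n

lemma le_branchRatio (h : IsRatioPair A B a b) (n : ℕ) (c : Bool) :
    A ≤ branchRatio (a n) (b n) c := by
  cases c
  · exact h.le_a n
  · exact h.le_b n

lemma branchRatio_le (h : IsRatioPair A B a b) (n : ℕ) (c : Bool) :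
    branchRatio (a n) (b n) c ≤ B := by
  have h1 := h.add_le n
  have h2 := h.a_pos n
  have h3 := h.b_pos n
  cases c <;> simp only [branchRatio] <;> simp <;> linarith

lemma length_succ_le (h : IsRatioPair A B a b) (v : ℕ → Bool) (n : ℕ) :
    moranLength a b v (n + 1) ≤ B * moranLength a b v n :=
  mul_le_mul_of_nonneg_right (h.branchRatio_le n _) (h.length_pos v n).le

lemma length_antitone (h : IsRatioPair A B a b) (v : ℕ → Bool) :
    Antitone (moranLength a b v) :=
  antitone_nat_of_succ_le fun n => (h.length_succ_le v n).trans <|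
    mul_le_of_le_one_left (h.length_pos v n).le h.B_lt_one.le

lemma length_le_pow (h : IsRatioPair A B a b) (v : ℕ → Bool) (n : ℕ) :
    moranLength a b v n ≤ B ^ n := by
  induction n with
  | zero => simp [moranLength]
  | succ n ih =>
    rw [pow_succ']
    exact (h.length_succ_le v n).trans (mul_le_mul_of_nonneg_left ih h.B_pos.le)

lemma pow_mul_length_le (h : IsRatioPair A B a b) (v : ℕ → Bool) (N n : ℕ) :
    A ^ n * moranLength a b v N ≤ moranLength a b v (N + n) := by
  induction n with
  | zero => simp
  | succ n ih =>
    rw [← add_assoc, moranLength_succ, pow_succ', mul_assoc]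
    exact mul_le_mul (h.le_branchRatio _ _) ih
      (mul_nonneg (pow_nonneg h.A_pos.le n) (h.length_pos v N).le)
      (h.A_pos.le.trans (h.le_branchRatio _ _))

lemma tendsto_length (h : IsRatioPair A B a b) (v : ℕ → Bool) :
    Tendsto (moranLength a b v) atTop (𝓝 0) :=
  squeeze_zero (fun n => (h.length_pos v n).le) (h.length_le_pow v)
    (tendsto_pow_atTop_nhds_zero_of_lt_one h.B_pos.le h.B_lt_one)

/-- Branches that separate at step `k` give points that are `(1 - B)` times the length of the
common interval apart. -/
lemma le_abs_moranPoint_sub (h : IsRatioPair A B a b) {v w : ℕ → Bool} {k : ℕ}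
    (hvw : ∀ i < k, w i = v i) (hk : w k ≠ v k) :
    (1 - B) * moranLength a b v k ≤ |moranPoint a b w - moranPoint a b v| := by
  have hv := moranPoint_mem h.a_pos h.b_pos h.add_lt v (k + 1)
  have hw := moranPoint_mem h.a_pos h.b_pos h.add_lt w (k + 1)
  have hl := h.length_pos v k
  have hab := h.add_le k
  simp only [moranInterval, moranLeft, moranLength, mem_Icc, moranLeft_congr hvw,
    moranLength_congr hvw] at hv hw
  cases h1 : v k <;> cases h2 : w k <;> simp only [h1, h2] at hk hv hw
  · exact absurd rfl hk
  · simp only [if_true, Bool.false_eq_true, if_false] at hv hw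
    refine le_trans ?_ (le_abs_self _)
    nlinarith [hv.2, hw.1]
  · simp only [if_true, Bool.false_eq_true, if_false] at hv hw
    refine le_trans ?_ (neg_le_abs _)
    nlinarith [hw.2, hv.1]
  · exact absurd rfl hk

/-- A first disagreement at some level `k < n` would already separate the points by `(1 - B) *
moranLength a b v k ≥ R`. -/
lemma eq_of_abs_moranPoint_sub_lt (h : IsRatioPair A B a b) {v w : ℕ → Bool} {n : ℕ} {R : ℝ}
    (hd : |moranPoint a b w - moranPoint a b v| < R)
    (hR : ∀ k < n, R ≤ (1 - B) * moranLength a b v k) : ∀ i < n, w i = v i := by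
  intro i
  induction i using Nat.strong_induction_on with
  | _ i ih =>
    intro hi
    by_contra hne
    exact absurd (h.le_abs_moranPoint_sub (fun j hj => ih j hj (hj.trans hi)) hne)
      (not_le.2 (hd.trans_le (hR i hi)))

lemma abs_moranPoint_sub_le (h : IsRatioPair A B a b) {v w : ℕ → Bool} {n : ℕ}
    (hvw : ∀ i < n, w i = v i) :
    |moranPoint a b w - moranPoint a b v| ≤ moranLength a b v n := by
  have hv := moranPoint_mem h.a_pos h.b_pos h.add_lt v n
  have hw := (moranPoint_mem_iff h.a_pos h.b_pos h.add_lt v w n).2 hvw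
  rw [moranInterval, mem_Icc] at hv hw
  rw [abs_le]
  constructor <;> linarith [hv.1, hv.2, hw.1, hw.2]

/-- Agreement on the first `n` levels is a neighbourhood in the product topology. Continuity makes
the set of coded points compact, so it contains the support, and every centre of a ball comes from a
branch. -/
lemma continuous_moranPoint (h : IsRatioPair A B a b) : Continuous (moranPoint a b) := by
  rw [continuous_iff_continuousAt]
  intro v
  rw [ContinuousAt, Metric.tendsto_nhds]
  intro ε hε
  obtain ⟨n, hn⟩ := ((h.tendsto_length v).eventually (gt_mem_nhds hε)).exists
  have hev : ∀ᶠ w in 𝓝 v, ∀ i ∈ Finset.range n, w i = v i := by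
    rw [Finset.eventually_all]
    intro i _
    have : Tendsto (fun w : ℕ → Bool => w i) (𝓝 v) (𝓝 (v i)) := (continuous_apply i).continuousAt
    rw [nhds_discrete Bool] at this
    exact tendsto_pure.1 this
  filter_upwards [hev] with w hw
  rw [Real.dist_eq]
  exact (h.abs_moranPoint_sub_le fun i hi => hw i (Finset.mem_range.2 hi)).trans_lt hn

lemma isClosed_range_moranPoint (h : IsRatioPair A B a b) : IsClosed (range (moranPoint a b)) :=
  (isCompact_range h.continuous_moranPoint).isClosed

lemma moranMeasure_moranInterval_eq (h : IsRatioPair A B a b) (p : ℕ → unitInterval)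
    (v : ℕ → Bool) (n : ℕ) :
    moranMeasure a b p (moranInterval a b v n) = ENNReal.ofReal (branchMass p v n) := by
  induction n with
  | zero =>
    rw [moranMeasure_moranInterval h.a_pos h.b_pos h.add_lt]
    simp [branchMass]
  | succ n ih =>
    rw [branchMass_succ, mul_comm]
    have hnn : 0 ≤ branchWeight (p n) (v n) := by
      cases v n
      · exact (p n).2.1
      · simpa [branchWeight] using (p n).2.2
    rw [ENNReal.ofReal_mul hnn, ← ih]
    cases hv : v n
    · exact moranMeasure_left h.a_pos h.b_pos h.add_lt p v n hv
    · exact moranMeasure_right h.a_pos h.b_pos h.add_lt p v n hv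

lemma support_subset_range (h : IsRatioPair A B a b) (p : ℕ → unitInterval) :
    (moranMeasure a b p).support ⊆ range (moranPoint a b) := by
  refine Measure.support_subset_of_isClosed h.isClosed_range_moranPoint ?_
  rw [mem_ae_iff, moranMeasure, Measure.map_apply (measurable_moranPoint a b)
    h.isClosed_range_moranPoint.measurableSet.compl, preimage_compl, preimage_range,
    compl_univ, measure_empty]

lemma measure_ball_le (h : IsRatioPair A B a b) (p : ℕ → unitInterval) {v : ℕ → Bool} {n : ℕ}
    {R : ℝ} (hR : ∀ k < n, R ≤ (1 - B) * moranLength a b v k) :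
    moranMeasure a b p (Metric.ball (moranPoint a b v) R) ≤
      ENNReal.ofReal (branchMass p v n) := by
  rw [← h.moranMeasure_moranInterval_eq, moranMeasure,
    Measure.map_apply (measurable_moranPoint a b) Metric.isOpen_ball.measurableSet,
    Measure.map_apply (measurable_moranPoint a b)
      (by exact measurableSet_Icc : MeasurableSet (moranInterval a b v n))]
  refine measure_mono fun w hw => ?_
  rw [mem_preimage, Metric.mem_ball, Real.dist_eq] at hw
  exact (moranPoint_mem_iff h.a_pos h.b_pos h.add_lt v w n).2 (h.eq_of_abs_moranPoint_sub_lt hw hR)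

lemma le_measure_ball (h : IsRatioPair A B a b) (p : ℕ → unitInterval) {v : ℕ → Bool} {n : ℕ}
    {r : ℝ} (hr : moranLength a b v n < r) :
    ENNReal.ofReal (branchMass p v n) ≤
      moranMeasure a b p (Metric.ball (moranPoint a b v) r) := by
  rw [← h.moranMeasure_moranInterval_eq]
  refine measure_mono fun x hx => ?_
  have hv := moranPoint_mem h.a_pos h.b_pos h.add_lt v n
  rw [moranInterval, mem_Icc] at hv hx
  rw [Metric.mem_ball, Real.dist_eq, abs_lt]
  constructor <;> linarith [hv.1, hv.2, hx.1, hx.2]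

lemma moranPoint_mem_support (h : IsRatioPair A B a b) {p : ℕ → unitInterval}
    (hp : ∀ n, (p n : ℝ) ∈ Ioo (0 : ℝ) 1) (v : ℕ → Bool) :
    moranPoint a b v ∈ (moranMeasure a b p).support := by
  rw [Metric.nhds_basis_ball.mem_measureSupport]
  intro r hr
  obtain ⟨n, hn⟩ := ((h.tendsto_length v).eventually (gt_mem_nhds hr)).exists
  exact (ENNReal.ofReal_pos.2 (branchMass_pos hp v n)).trans_le (h.le_measure_ball p hn)

/-- Iteration of `branchRatio_rpow_le` over the levels `N, …, N + n - 1`, in product form to avoid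
quotients. -/
lemma branchMass_mul_rpow_le (h : IsRatioPair A B a b) {p : ℕ → unitInterval}
    (hp : ∀ n, (p n : ℝ) ∈ Ioo (0 : ℝ) 1) (v : ℕ → Bool) (d : ℝ) (N n : ℕ) :
    branchMass p v N * moranLength a b v (N + n) ^ d ≤
      Real.exp (∑ i ∈ Finset.range n, excess d (a (N + i)) (b (N + i)) (p (N + i))) *
        (moranLength a b v N ^ d * branchMass p v (N + n)) := by
  induction n with
  | zero => simp [mul_comm]
  | succ n ih =>
    have hstep := branchRatio_rpow_le (θ := d) (h.a_pos (N + n)) (h.b_pos (N + n)) (hp (N + n))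
      (v (N + n))
    rw [← add_assoc, moranLength_succ, branchMass_succ, Finset.sum_range_succ, Real.exp_add,
      Real.mul_rpow (h.A_pos.le.trans (h.le_branchRatio _ _)) (h.length_pos v _).le]
    have h0 : 0 ≤ branchMass p v N * moranLength a b v (N + n) ^ d :=
      mul_nonneg (branchMass_pos hp v N).le (Real.rpow_nonneg (h.length_pos v _).le _)
    have h1 := mul_le_mul hstep ih h0 (mul_nonneg (Real.exp_pos _).le (branchWeight_pos (hp _) _).le)
    calc _ = branchRatio (a (N + n)) (b (N + n)) (v (N + n)) ^ d *
          (branchMass p v N * moranLength a b v (N + n) ^ d) := by ring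
      _ ≤ _ := h1
      _ = _ := by ring

/-- The branch of greatest mass relative to the `θ`-th power of the length. -/
lemma exp_mul_branchMass_bestChild (h : IsRatioPair A B a b) {p : ℕ → unitInterval}
    (hp : ∀ n, (p n : ℝ) ∈ Ioo (0 : ℝ) 1) (θ : ℝ) (n : ℕ) :
    Real.exp (∑ i ∈ Finset.range n, excess θ (a i) (b i) (p i)) *
        branchMass p (fun i => bestChild θ (a i) (b i) (p i)) n =
      moranLength a b (fun i => bestChild θ (a i) (b i) (p i)) n ^ θ := by
  induction n with
  | zero => simp [branchMass, moranLength]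
  | succ n ih =>
    rw [moranLength_succ, branchMass_succ, Finset.sum_range_succ, Real.exp_add,
      Real.mul_rpow (h.A_pos.le.trans (h.le_branchRatio _ _)) (h.length_pos _ _).le, ← ih,
      ← exp_excess_mul_branchWeight (h.a_pos n) (h.b_pos n) (hp n)]
    ring

end IsRatioPair

/-! ### Deterministic bounds on admissible exponents -/

/-- The first bound lets additive constants be absorbed into multiples of `log |log R|`, the second
makes windows long, the third bounds the starting level by `|log R| ^ 2`. -/
lemma IsLarge.eventually {Φ : ℝ → ℝ} (hΦ : IsLarge Φ) (K c e : ℝ) (hc : 0 < c) :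
    ∀ᶠ R in 𝓝[>] (0 : ℝ), 1 ≤ Real.log (-Real.log R) ∧
      K * Real.log (-Real.log R) ≤ Φ R * -Real.log R ∧
      -Real.log R + e ≤ c * (-Real.log R) ^ 2 := by
  obtain ⟨H, hH, hΦH⟩ := hΦ
  have hlog : Tendsto (fun R => -Real.log R) (𝓝[>] (0 : ℝ)) atTop :=
    tendsto_neg_atBot_atTop.comp Real.tendsto_log_nhdsGT_zero
  have hloglog : Tendsto (fun R => Real.log (-Real.log R)) (𝓝[>] (0 : ℝ)) atTop :=
    Real.tendsto_log_atTop.comp hlog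
  filter_upwards [hH.eventually_ge_atTop K, hΦH, hloglog.eventually_ge_atTop 1,
    hlog.eventually_ge_atTop 1, hlog.eventually_ge_atTop ((1 + |e|) / c)] with R h1 h2 h3 h4 h5
  refine ⟨h3, ?_, ?_⟩
  · have habs : |Real.log R| = -Real.log R := abs_of_neg (by linarith)
    rw [h2, habs, mul_assoc, div_mul_cancel₀ _ (by linarith)]
    exact mul_le_mul_of_nonneg_right h1 (by linarith)
  · rw [div_le_iff₀ hc] at h5
    have := le_abs_self e
    have := abs_nonneg e
    nlinarith

namespace IsRatioPair

variable {A B : ℝ} {a b : ℕ → ℝ}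

/-- Deterministic upper bound: `d` is admissible when the excesses have nonpositive sums over all
windows `[N, N + n)` that are at least logarithmically long in `N`. -/
theorem mem_upperExponents (h : IsRatioPair A B a b) {p : ℕ → unitInterval}
    (hp : ∀ n, (p n : ℝ) ∈ Ioo (0 : ℝ) 1) {d τ : ℝ} (hd : 0 ≤ d) (hτ0 : 0 < τ) (hτ1 : τ < 1)
    {n₀ : ℕ} (hS : ∀ n, n₀ ≤ n → ∀ N : ℕ, (N : ℝ) * τ ^ n ≤ 1 →
      ∑ i ∈ Finset.range n, excess d (a (N + i)) (b (N + i)) (p (N + i)) ≤ 0)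
    {Φ : ℝ → ℝ} (hΦ : IsLarge Φ) : d ∈ upperExponents Φ (moranMeasure a b p) := by
  have hA0 := h.A_pos
  have hA1 : A < 1 := h.A_lt_B.trans h.B_lt_one
  have hB0 := h.B_pos
  have hB1 : 0 < 1 - B := by linarith [h.B_lt_one]
  have hlogA : 0 < -Real.log A := by linarith [Real.log_neg hA0 hA1]
  have hlogB : 0 < -Real.log B := by linarith [Real.log_neg hB0 h.B_lt_one]
  have hlogτ : 0 < -Real.log τ := by linarith [Real.log_neg hτ0 hτ1]
  -- The factor `2 / -log τ` yields `|log R| ^ 2 * τ ^ n ≤ 1`; `n₀ + 2` absorbs the threshold `n₀`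
  -- and the off-by-one in `hn1`.
  obtain ⟨u, hu, hsub⟩ := mem_nhdsGT_iff_exists_Ioc_subset.1
    (hΦ.eventually (-Real.log A * (2 / -Real.log τ + n₀ + 2)) (-Real.log B) (-Real.log A) hlogB)
  -- The constant `C₂` below comes from `|I_N| ≤ R / (1 - B)` and `|I_M| ≥ A * r`.
  have hu0 : (0 : ℝ) < u := hu
  refine ⟨min u ((1 - B) / 2), (1 / ((1 - B) * A)) ^ d, lt_min hu (by linarith),
    (min_le_right _ _).trans_lt (by linarith), by positivity, ?_⟩
  intro r R hr hrR hRR hR0 hRC x hx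
  obtain ⟨h1, h2, h3⟩ := hsub ⟨hR0, hRC.trans (min_le_left _ _)⟩
  have hRB : R < 1 - B := (hRC.trans (min_le_right _ _)).trans_lt (by linarith)
  have hR1 : R < 1 := by linarith
  have hrR' : r < R := hrR.trans_le hRR
  obtain ⟨v, rfl⟩ := h.support_subset_range p hx
  have hlim := h.tendsto_length v
  classical
  -- the smallest interval around the point that contains the ball of radius `R`
  have exN : ∃ k, (1 - B) * moranLength a b v k < R :=
    ((by simpa using hlim.const_mul (1 - B) :
      Tendsto (fun k => (1 - B) * moranLength a b v k) atTop (𝓝 0)).eventually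
        (gt_mem_nhds hR0)).exists
  have exM : ∃ k, moranLength a b v k < r := (hlim.eventually (gt_mem_nhds hr)).exists
  obtain ⟨N, hN, hNmin⟩ : ∃ N, (1 - B) * moranLength a b v N < R ∧
      ∀ k < N, R ≤ (1 - B) * moranLength a b v k :=
    ⟨Nat.find exN, Nat.find_spec exN, fun k hk => not_lt.1 (Nat.find_min exN hk)⟩
  -- The first interval along `v` shorter than `r`; it lies inside the ball of radius `r`.
  obtain ⟨M, hM, hMmin⟩ : ∃ M, moranLength a b v M < r ∧
      ∀ k < M, r ≤ moranLength a b v k :=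
    ⟨Nat.find exM, Nat.find_spec exM, fun k hk => not_lt.1 (Nat.find_min exM hk)⟩
  have hNM : N ≤ M := by
    by_contra hlt
    have := hNmin M (not_le.1 hlt)
    have := h.length_pos v M
    nlinarith
  have hLN : A * R ≤ moranLength a b v N := by
    rcases N with _ | N
    · simp only [moranLength]; nlinarith
    · have h4 := hNmin N (Nat.lt_succ_self N)
      have h5 := h.length_pos v N
      rw [moranLength_succ]
      exact mul_le_mul (h.le_branchRatio _ _) (by nlinarith) hR0.le
        (hA0.le.trans (h.le_branchRatio _ _))
  have hLM : A * r ≤ moranLength a b v M := by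
    rcases M with _ | M
    · simp only [moranLength]; nlinarith
    · rw [moranLength_succ]
      exact mul_le_mul (h.le_branchRatio _ _) (hMmin M (Nat.lt_succ_self M)) hr.le
        (hA0.le.trans (h.le_branchRatio _ _))
  obtain ⟨n, rfl⟩ := Nat.exists_eq_add_of_le hNM
  -- Each level shrinks lengths by a factor at least `A`, and `|I_N| ≥ A * R` costs one more factor:
  -- hence `n + 1`.
  have hn1 : -Real.log R * Φ R ≤ (n + 1) * -Real.log A := by
    have h4 : A ^ (n + 1) * R < R * R ^ (Φ R) := by
      calc A ^ (n + 1) * R = A ^ n * (A * R) := by ring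
        _ ≤ A ^ n * moranLength a b v N := by gcongr
        _ ≤ moranLength a b v (N + n) := h.pow_mul_length_le v N n
        _ < r := hM
        _ < _ := hrR
        _ = _ := by rw [Real.rpow_add hR0, Real.rpow_one]
    have h5 : A ^ (n + 1) < R ^ (Φ R) := by
      rw [mul_comm R] at h4
      exact lt_of_mul_lt_mul_right h4 hR0.le
    have h6 := Real.log_lt_log (by positivity) h5
    rw [Real.log_pow, Real.log_rpow hR0] at h6
    push_cast at h6
    linarith
  have hn2 : 2 / -Real.log τ * Real.log (-Real.log R) + n₀ ≤ n := by
    have h4 : -Real.log A * ((2 / -Real.log τ + n₀ + 2) * Real.log (-Real.log R)) ≤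
        -Real.log A * (n + 1) := by linarith
    have h5 := le_of_mul_le_mul_left h4 hlogA
    have h6 : (0 : ℝ) ≤ n₀ := Nat.cast_nonneg _
    nlinarith
  have hlam : 0 < -Real.log R := by linarith [Real.log_neg hR0 hR1]
  have hNle : (N : ℝ) ≤ (-Real.log R) ^ 2 := by
    have h4 := Real.log_le_log (by positivity) (hLN.trans (h.length_le_pow v N))
    rw [Real.log_mul hA0.ne' hR0.ne', Real.log_pow] at h4
    have h5 : -Real.log B * N ≤ -Real.log B * (-Real.log R) ^ 2 := by linarith
    exact le_of_mul_le_mul_left h5 hlogB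
  have hwin : (N : ℝ) * τ ^ n ≤ 1 := by
    have h4 : (-Real.log R) ^ 2 * τ ^ n ≤ 1 := by
      rw [← Real.log_nonpos_iff (by positivity), Real.log_mul (by positivity) (by positivity),
        Real.log_pow, Real.log_pow]
      have h5 : 2 / -Real.log τ * Real.log (-Real.log R) ≤ n := by
        have : (0 : ℝ) ≤ n₀ := Nat.cast_nonneg _
        linarith
      rw [div_mul_eq_mul_div, div_le_iff₀ hlogτ] at h5
      push_cast
      linarith
    exact (mul_le_mul_of_nonneg_right hNle (by positivity)).trans h4
  have hn0 : n₀ ≤ n := by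
    have : (0 : ℝ) ≤ 2 / -Real.log τ * Real.log (-Real.log R) := by positivity
    exact_mod_cast (by linarith : (n₀ : ℝ) ≤ n)
  have hmass : branchMass p v N * moranLength a b v (N + n) ^ d ≤
      moranLength a b v N ^ d * branchMass p v (N + n) := by
    refine (h.branchMass_mul_rpow_le hp v d N n).trans (mul_le_of_le_one_left ?_ ?_)
    · exact mul_nonneg (Real.rpow_nonneg (h.length_pos v _).le _) (branchMass_pos hp v _).le
    · exact Real.exp_le_one_iff.2 (hS n hn0 N hwin)
  have hpos := branchMass_pos hp v (N + n)
  have hLpos := h.length_pos v (N + n)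
  have hratio : branchMass p v N / branchMass p v (N + n) ≤
      (1 / ((1 - B) * A)) ^ d * (R / r) ^ d := by
    calc branchMass p v N / branchMass p v (N + n)
        ≤ moranLength a b v N ^ d / moranLength a b v (N + n) ^ d := by
          rw [div_le_div_iff₀ hpos (by positivity)]
          exact hmass
      _ = (moranLength a b v N / moranLength a b v (N + n)) ^ d :=
          (Real.div_rpow (h.length_pos v N).le hLpos.le d).symm
      _ ≤ (1 / ((1 - B) * A) * (R / r)) ^ d := by
          refine Real.rpow_le_rpow (div_nonneg (h.length_pos v N).le hLpos.le) ?_ hd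
          have : 1 / ((1 - B) * A) * (R / r) = (R / (1 - B)) / (A * r) := by field_simp
          rw [this]
          refine div_le_div₀ (by positivity) ?_ (by positivity) hLM
          rw [le_div_iff₀ hB1]
          linarith
      _ = _ := Real.mul_rpow (by positivity) (by positivity)
  calc _ ≤ ENNReal.ofReal (branchMass p v N) / ENNReal.ofReal (branchMass p v (N + n)) :=
        ENNReal.div_le_div (h.measure_ball_le p hNmin) (h.le_measure_ball p hM)
    _ = ENNReal.ofReal (branchMass p v N / branchMass p v (N + n)) :=
        (ENNReal.ofReal_div_of_pos hpos).symm
    _ ≤ _ := ENNReal.ofReal_le_ofReal hratio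

/-- Deterministic lower bound: the mean of the excesses of exponent `α` vanishes asymptotically
only if all admissible exponents are at least `α`. -/
theorem le_of_mem_upperExponents (h : IsRatioPair A B a b) {p : ℕ → unitInterval}
    (hp : ∀ n, (p n : ℝ) ∈ Ioo (0 : ℝ) 1) {α d : ℝ}
    (hS : Tendsto (fun n : ℕ => (∑ i ∈ Finset.range n, excess α (a i) (b i) (p i)) / n)
      atTop (𝓝 0)) {Φ : ℝ → ℝ} (hΦ : IsDimensionFunction Φ)
    (hd : d ∈ upperExponents Φ (moranMeasure a b p)) : α ≤ d := by
  by_contra! hlt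
  obtain ⟨R, C₂, hR0, hR1, hC₂, hC⟩ := hd
  have hB0 := h.B_pos
  have hB1 : 0 < 1 - B := by linarith [h.B_lt_one]
  set v : ℕ → Bool := fun i => bestChild α (a i) (b i) (p i) with hv
  set S : ℕ → ℝ := fun n => ∑ i ∈ Finset.range n, excess α (a i) (b i) (p i) with hSdef
  have hx := h.moranPoint_mem_support hp v
  have hlim := h.tendsto_length v
  -- Exponential rate at which `|I_n| ^ (α - d)` decays, from `|I_n| ≤ B ^ n`. Half of it is given
  -- up to the excess sums.
  set ε : ℝ := (α - d) * -Real.log B with hε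
  have hε0 : 0 < ε := mul_pos (by linarith) (by linarith [Real.log_neg hB0 h.B_lt_one])
  set μR := moranMeasure a b p (Metric.ball (moranPoint a b v) R) with hμR
  have hμRpos : 0 < μR := (Metric.nhds_basis_ball.mem_measureSupport.1 hx) R hR0
  have hμRtop : μR ≠ ⊤ := measure_ne_top _ _
  set C : ℝ := C₂ * (R / (1 - B)) ^ d with hCdef
  have hRΦ : R ^ (1 + Φ R) ≤ R := by
    conv_rhs => rw [← Real.rpow_one R]
    exact Real.rpow_le_rpow_of_exponent_ge hR0 hR1.le (by linarith [hΦ.nonneg R ⟨hR0, hR1⟩])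
  have hsmall : ∀ᶠ n in atTop, (1 - B) * moranLength a b v n < R ^ (1 + Φ R) :=
    (by simpa using hlim.const_mul (1 - B) :
      Tendsto (fun k => (1 - B) * moranLength a b v k) atTop (𝓝 0)).eventually
        (gt_mem_nhds (Real.rpow_pos_of_pos hR0 _))
  have hkey : ∀ᶠ n : ℕ in atTop, μR.toReal ≤ C * Real.exp (-(ε / 2) * n) := by
    have hS' := hS.eventually (lt_mem_nhds (show -(ε / 2) < 0 by linarith))
    filter_upwards [hsmall, hS', eventually_gt_atTop 0] with n hn hSn hn0
    have hL := h.length_pos v n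
    -- With this radius the small ball has mass at most that of `I_n`, because the lengths of all
    -- earlier intervals on the branch are at least `|I_n|`.
    have hbig := hC ((1 - B) * moranLength a b v n) R (by positivity) hn hRΦ hR0 le_rfl _ hx
    have hball : moranMeasure a b p (Metric.ball (moranPoint a b v)
        ((1 - B) * moranLength a b v n)) ≤ ENNReal.ofReal (branchMass p v n) :=
      h.measure_ball_le p fun k hk =>
        mul_le_mul_of_nonneg_left (h.length_antitone v hk.le) hB1.le
    have hle : μR ≤ ENNReal.ofReal (C₂ * (R / ((1 - B) * moranLength a b v n)) ^ d *
        branchMass p v n) := by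
      rw [ENNReal.ofReal_mul (by positivity)]
      have h0 : moranMeasure a b p (Metric.ball (moranPoint a b v)
          ((1 - B) * moranLength a b v n)) ≠ 0 :=
        ((Metric.nhds_basis_ball.mem_measureSupport.1 hx) _ (by positivity)).ne'
      refine le_trans ?_ (mul_le_mul' hbig hball)
      rw [ENNReal.div_mul_cancel h0 (measure_ne_top _ _)]
    have hle' := ENNReal.toReal_le_of_le_ofReal
      (mul_nonneg (by positivity) (branchMass_pos hp v n).le) hle
    refine hle'.trans ?_
    have hexp : Real.exp (S n) * branchMass p v n = moranLength a b v n ^ α :=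
      h.exp_mul_branchMass_bestChild hp α n
    have hmass : branchMass p v n = moranLength a b v n ^ α * Real.exp (-S n) := by
      rw [← hexp, mul_comm, ← mul_assoc, ← Real.exp_add]; simp
    have hLd : moranLength a b v n ^ α = moranLength a b v n ^ d * moranLength a b v n ^ (α - d) := by
      rw [← Real.rpow_add hL]; ring_nf
    have hLB : moranLength a b v n ^ (α - d) ≤ Real.exp (-ε * n) := by
      calc moranLength a b v n ^ (α - d) ≤ (B ^ n) ^ (α - d) :=
            Real.rpow_le_rpow hL.le (h.length_le_pow v n) (by linarith)
        _ = Real.exp (-ε * n) := by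
            rw [Real.rpow_def_of_pos (by positivity), Real.log_pow, hε]
            ring_nf
    have hn0' : (0 : ℝ) < n := by exact_mod_cast hn0
    have hSn' : -(ε / 2) * n < S n := by
      rwa [lt_div_iff₀ hn0'] at hSn
    have hdiv : (R / ((1 - B) * moranLength a b v n)) ^ d * moranLength a b v n ^ d =
        (R / (1 - B)) ^ d := by
      rw [← Real.mul_rpow (by positivity) hL.le]
      congr 1
      field_simp
    calc C₂ * (R / ((1 - B) * moranLength a b v n)) ^ d * branchMass p v n
        = C₂ * ((R / ((1 - B) * moranLength a b v n)) ^ d * moranLength a b v n ^ d) *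
            (moranLength a b v n ^ (α - d) * Real.exp (-S n)) := by
          rw [hmass, hLd]; ring
      _ = C * (moranLength a b v n ^ (α - d) * Real.exp (-S n)) := by rw [hdiv]
      _ ≤ C * (Real.exp (-ε * n) * Real.exp (ε / 2 * n)) := by
          gcongr
          linarith
      _ = _ := by rw [← Real.exp_add]; ring_nf
  have hzero : Tendsto (fun n : ℕ => C * Real.exp (-(ε / 2) * n)) atTop (𝓝 0) := by
    have h1 : Tendsto (fun n : ℕ => -(ε / 2) * (n : ℝ)) atTop atBot :=
      tendsto_natCast_atTop_atTop.const_mul_atTop_of_neg (by linarith)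
    simpa using (Real.tendsto_exp_atBot.comp h1).const_mul C
  exact absurd (ge_of_tendsto hzero hkey) (not_le.2 (ENNReal.toReal_pos hμRpos.ne' hμRtop))

end IsRatioPair

/-- An exponent that is a limit from above of admissible ones and a lower bound for them is the
upper `Φ`-dimension. -/
theorem upperPhiDim_eq {X : Type*} [PseudoMetricSpace X] [MeasurableSpace X]
    {Φ : ℝ → ℝ} {μ : Measure X} {α : ℝ} (hle : ∀ d ∈ upperExponents Φ μ, α ≤ d)
    (hmem : ∀ k : ℕ, α + 1 / ((k : ℝ) + 1) ∈ upperExponents Φ μ) :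
    upperPhiDim Φ μ = (α : EReal) := by
  refine le_antisymm ?_ ?_
  · have hlim : Tendsto (fun k : ℕ => ((α + 1 / ((k : ℝ) + 1) : ℝ) : EReal)) atTop
        (𝓝 (α : EReal)) := by
      refine (continuous_coe_real_ereal.tendsto α).comp ?_
      simpa using (tendsto_one_div_add_atTop_nhds_zero_nat (𝕜 := ℝ)).const_add α
    exact ge_of_tendsto' hlim fun k => sInf_le ⟨_, hmem k, rfl⟩
  · refine le_sInf ?_
    rintro _ ⟨d, hd, rfl⟩
    exact EReal.coe_le_coe_iff.2 (hle d hd)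

/-! ### Independence of the triples of ratios and probabilities -/

section Independence

variable {Ω ι : Type*} [MeasurableSpace Ω] {P : Measure Ω}

/-- Two independent families of independent variables form a family of independent pairs. -/
lemma iIndepFun_prodMk {E F : Type*} [mE : MeasurableSpace E] [mF : MeasurableSpace F]
    {X : ι → Ω → E} {Y : ι → Ω → F} (mX : ∀ i, Measurable (X i)) (mY : ∀ i, Measurable (Y i))
    (hX : iIndepFun X P) (hY : iIndepFun Y P)
    (hXY : IndepFun (fun ω i => X i ω) (fun ω i => Y i ω) P) :
    iIndepFun (fun i ω => (X i ω, Y i ω)) P := by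
  -- Measurable rectangles form a generating π-system, so independence need only be checked on them.
  set π : Set (Set (E × F)) :=
    image2 (· ×ˢ ·) {s : Set E | MeasurableSet s} {t : Set F | MeasurableSet t} with hπ
  refine (iIndepFun_iff_iIndep _ _ _).2 ?_
  refine iIndepSets.iIndep (fun i => ((mX i).prodMk (mY i)).comap_le)
    (fun i => {s | ∃ t ∈ π, (fun ω => (X i ω, Y i ω)) ⁻¹' t = s})
    (fun i => isPiSystem_prod.comap _) (fun i => ?_) ?_
  · rw [← generateFrom_prod, MeasurableSpace.comap_generateFrom]
    rfl
  · rw [iIndepSets_iff]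
    intro S f hf
    have hf' : ∀ i, ∃ s : Set E, ∃ t : Set F, MeasurableSet s ∧ MeasurableSet t ∧
        (i ∈ S → f i = X i ⁻¹' s ∩ Y i ⁻¹' t) := by
      intro i
      by_cases hi : i ∈ S
      · obtain ⟨_, ⟨s, hs, t, ht, rfl⟩, h⟩ := hf i hi
        exact ⟨s, t, hs, ht, fun _ => h.symm⟩
      · exact ⟨∅, ∅, .empty, .empty, fun h => absurd h hi⟩
    choose s t hs ht hst using hf'
    -- Used for `T = S` to separate the two families, then for singletons to reassemble each pair.
    have hmul : ∀ T : Finset ι, P ((⋂ i ∈ T, X i ⁻¹' s i) ∩ ⋂ i ∈ T, Y i ⁻¹' t i) =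
        P (⋂ i ∈ T, X i ⁻¹' s i) * P (⋂ i ∈ T, Y i ⁻¹' t i) := by
      intro T
      have h1 : MeasurableSet {x : ι → E | ∀ i ∈ T, x i ∈ s i} := by
        have : {x : ι → E | ∀ i ∈ T, x i ∈ s i} = ⋂ i ∈ T, (fun x : ι → E => x i) ⁻¹' s i := by
          ext; simp
        rw [this]
        exact T.measurableSet_biInter fun i _ => measurable_pi_apply i (hs i)
      have h2 : MeasurableSet {x : ι → F | ∀ i ∈ T, x i ∈ t i} := by
        have : {x : ι → F | ∀ i ∈ T, x i ∈ t i} = ⋂ i ∈ T, (fun x : ι → F => x i) ⁻¹' t i := by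
          ext; simp
        rw [this]
        exact T.measurableSet_biInter fun i _ => measurable_pi_apply i (ht i)
      have h3 := indepFun_iff_measure_inter_preimage_eq_mul.1 hXY _ _ h1 h2
      convert h3 using 2
      · congr 1 <;> (ext; simp)
      · congr 1; ext; simp
      · congr 1; ext; simp
    have hsplit : ⋂ i ∈ S, f i = (⋂ i ∈ S, X i ⁻¹' s i) ∩ ⋂ i ∈ S, Y i ⁻¹' t i := by
      ext ω
      simp only [mem_inter_iff, mem_iInter, ← forall_and]
      exact forall₂_congr fun i hi => by rw [hst i hi, mem_inter_iff]
    rw [hsplit, hmul, hX.measure_inter_preimage_eq_mul S fun i _ => hs i,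
      hY.measure_inter_preimage_eq_mul S fun i _ => ht i, ← Finset.prod_mul_distrib]
    refine Finset.prod_congr rfl fun i hi => ?_
    rw [hst i hi]
    simpa using (hmul {i}).symm

end Independence

/-! ### Chernoff bound and Borel–Cantelli over windows -/

section LargeDeviations

variable {Ω : Type*} [MeasurableSpace Ω] {P : Measure Ω} [IsProbabilityMeasure P]

/-- A random variable of negative mean with exponential moments has a moment generating function
smaller than one somewhere on the right of `0`. -/
lemma exists_mgf_lt_one {X : Ω → ℝ} (hint : 0 ∈ interior (integrableExpSet X P))
    (hneg : ∫ ω, X ω ∂P < 0) :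
    ∃ s, 0 < s ∧ Integrable (fun ω => Real.exp (s * X ω)) P ∧ mgf X P s < 1 := by
  -- The moment generating function equals `1` at `0` and has the negative mean as its slope there.
  have hder : HasDerivAt (mgf X P) (∫ ω, X ω ∂P) 0 := by simpa using hasDerivAt_mgf hint
  have hslope := (hasDerivAt_iff_tendsto_slope_zero.1 hder).mono_left
    (nhdsWithin_mono 0 fun x (hx : x ∈ Ioi 0) => (mem_Ioi.1 hx).ne')
  have hmem : ∀ᶠ s in 𝓝[>] (0 : ℝ), s ∈ integrableExpSet X P :=
    nhdsWithin_le_nhds (mem_interior_iff_mem_nhds.1 hint)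
  obtain ⟨s, h1, h2, h3⟩ :=
    ((hslope.eventually (gt_mem_nhds hneg)).and (hmem.and self_mem_nhdsWithin)).exists
  have hs : 0 < s := h3
  refine ⟨s, hs, h2, ?_⟩
  simp only [zero_add, mgf_zero, smul_eq_mul] at h1
  rw [inv_mul_lt_iff₀ hs] at h1
  linarith

/-- Almost surely, the sums over windows `[N, N + n)` of i.i.d. variables of negative mean are
nonpositive as soon as `n` is large and at least logarithmically long in `N`. -/
lemma ae_sum_window_nonpos {X : ℕ → Ω → ℝ} (hmeas : ∀ i, Measurable (X i))
    (hindep : iIndepFun X P) (hident : ∀ i, IdentDistrib (X i) (X 0) P P)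
    (hint : 0 ∈ interior (integrableExpSet (X 0) P)) (hneg : ∫ ω, X 0 ω ∂P < 0) :
    ∃ τ : ℝ, 0 < τ ∧ τ < 1 ∧ ∀ᵐ ω ∂P, ∃ n₀ : ℕ, ∀ n, n₀ ≤ n → ∀ N : ℕ, (N : ℝ) * τ ^ n ≤ 1 →
      ∑ i ∈ Finset.range n, X (N + i) ω ≤ 0 := by
  obtain ⟨s, hs, hsint, hs1⟩ := exists_mgf_lt_one hint hneg
  have hρ0 : 0 < mgf (X 0) P s := mgf_pos hsint
  set ρ := mgf (X 0) P s with hρ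
  have hexp : ∀ i, Integrable (fun ω => Real.exp (s * X i ω)) P := fun i =>
    (((hident i).comp (measurable_const_mul s).exp).integrable_iff).2 hsint
  have htail : ∀ N n : ℕ, P {ω | 0 ≤ ∑ i ∈ Finset.range n, X (N + i) ω} ≤
      ENNReal.ofReal (ρ ^ n) := by
    intro N n
    have hind : iIndepFun (fun i => X (N + i)) P := hindep.precomp (add_right_injective N)
    have h1 := measure_ge_le_exp_mul_mgf (μ := P)
      (X := ∑ i ∈ Finset.range n, X (N + i)) 0 hs.le
      (hind.integrable_exp_mul_sum (fun i => hmeas (N + i)) fun i _ => hexp (N + i))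
    rw [hind.mgf_sum (fun i => hmeas (N + i)),
      Finset.prod_eq_pow_card fun i _ => mgf_congr_of_identDistrib _ _ (hident (N + i)) s] at h1
    simp only [Finset.sum_apply, mul_zero, Real.exp_zero, one_mul, Finset.card_range] at h1
    rw [← ofReal_measureReal]
    exact ENNReal.ofReal_le_ofReal h1
  -- With this choice about `τ ^ (-n)` starting levels, each of probability at most `ρ ^ n = τ ^ (2
  -- * n)`, contribute at most `2 * τ ^ n`, which is summable.
  set τ := Real.sqrt ρ with hτ
  have hτ0 : 0 < τ := Real.sqrt_pos.2 hρ0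
  have hτ1 : τ < 1 := by rw [hτ, Real.sqrt_lt' one_pos]; simpa using hs1
  have hτρ : τ * τ = ρ := Real.mul_self_sqrt hρ0.le
  refine ⟨τ, hτ0, hτ1, ?_⟩
  have hsum : ∑' n : ℕ, P (⋃ N ∈ Finset.range (⌊(τ ^ n)⁻¹⌋₊ + 1),
      {ω | 0 ≤ ∑ i ∈ Finset.range n, X (N + i) ω}) ≠ ⊤ := by
    refine ne_top_of_le_ne_top (b := ∑' n : ℕ, ENNReal.ofReal (2 * τ ^ n)) ?_ ?_
    · rw [← ENNReal.ofReal_tsum_of_nonneg (fun n => by positivity)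
        ((summable_geometric_of_lt_one hτ0.le hτ1).mul_left 2)]
      exact ENNReal.ofReal_ne_top
    · refine ENNReal.tsum_le_tsum fun n => ?_
      refine (measure_biUnion_finset_le _ _).trans ?_
      refine (Finset.sum_le_sum fun N _ => htail N n).trans ?_
      rw [Finset.sum_const, Finset.card_range, nsmul_eq_mul, ← ENNReal.ofReal_natCast,
        ← ENNReal.ofReal_mul (Nat.cast_nonneg _)]
      refine ENNReal.ofReal_le_ofReal ?_
      have hpow : 0 < τ ^ n := pow_pos hτ0 n
      have hpow1 : τ ^ n ≤ 1 := pow_le_one₀ hτ0.le hτ1.le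
      have hfl : (⌊(τ ^ n)⁻¹⌋₊ : ℝ) ≤ (τ ^ n)⁻¹ := Nat.floor_le (by positivity)
      have hfl' : (⌊(τ ^ n)⁻¹⌋₊ : ℝ) * τ ^ n ≤ 1 := by
        calc _ ≤ (τ ^ n)⁻¹ * τ ^ n := by gcongr
          _ = 1 := inv_mul_cancel₀ hpow.ne'
      rw [← hτρ, mul_pow]
      push_cast
      nlinarith
  filter_upwards [ae_eventually_notMem hsum] with ω hω
  obtain ⟨n₀, hn₀⟩ := eventually_atTop.1 hω
  refine ⟨n₀, fun n hn N hN => ?_⟩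
  have hnot := hn₀ n hn
  simp only [mem_iUnion, not_exists, Finset.mem_range, mem_ofPred_eq, not_le] at hnot
  refine (hnot N ?_).le
  rw [Nat.lt_succ_iff]
  refine Nat.le_floor ?_
  rw [← one_div, le_div_iff₀ (pow_pos hτ0 n)]
  exact hN

end LargeDeviations

/-! ### Excesses of the random model -/

/-- The `n`-th excess. -/
abbrev levelExcess {Ω : Type*} (a b : ℕ → Ω → ℝ) (p : ℕ → Ω → unitInterval) (θ : ℝ) (n : ℕ)
    (ω : Ω) : ℝ :=
  excess θ (a n ω) (b n ω) (p n ω)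

lemma measurable_excess (θ : ℝ) :
    Measurable fun z : (ℝ × ℝ) × unitInterval => excess θ z.1.1 z.1.2 z.2 := by
  have hx : Measurable fun z : (ℝ × ℝ) × unitInterval => z.1.1 := by fun_prop
  have hy : Measurable fun z : (ℝ × ℝ) × unitInterval => z.1.2 := by fun_prop
  have hq : Measurable fun z : (ℝ × ℝ) × unitInterval => (z.2 : ℝ) :=
    measurable_subtype_coe.comp measurable_snd
  have hset : MeasurableSet {z : (ℝ × ℝ) × unitInterval |
      (z.2 : ℝ) ≤ z.1.1 ^ θ / (z.1.1 ^ θ + z.1.2 ^ θ)} :=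
    measurableSet_le hq ((hx.pow_const θ).div ((hx.pow_const θ).add (hy.pow_const θ)))
  unfold excess Zval Yval
  exact ((Measurable.ite hset hx.log hy.log).const_mul θ).sub
    (Measurable.ite hset hq.log (measurable_const.sub hq).log)

namespace IsRandomMoranModel

variable {Ω : Type*} [MeasurableSpace Ω] {P : Measure Ω} {A B : ℝ}
  {a b : ℕ → Ω → ℝ} {p : ℕ → Ω → unitInterval}

lemma isRatioPair (h : IsRandomMoranModel P A B a b p) (ω : Ω) :
    IsRatioPair A B (fun n => a n ω) (fun n => b n ω) where
  A_pos := h.A_pos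
  A_lt_B := h.A_lt_B
  B_lt_one := h.B_lt_one
  le_a n := (h.le_min n ω).trans (min_le_left _ _)
  le_b n := (h.le_min n ω).trans (min_le_right _ _)
  add_le n := h.add_le n ω

/-- Since `0 ^ (-t) = ∞`, finite negative moments exclude the values `0` and `1` almost surely. -/
lemma ae_mem_Ioo (h : IsRandomMoranModel P A B a b p) :
    ∀ᵐ ω ∂P, ∀ n, (p n ω : ℝ) ∈ Ioo (0 : ℝ) 1 := by
  obtain ⟨t, ht, hmom⟩ := h.moment_p
  rw [ae_all_iff]
  intro n
  have hmeas : Measurable fun ω => (p n ω : ℝ) := (h.measurable_p n).subtype_val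
  have h1 := ae_lt_top ((hmeas.ennreal_ofReal).pow_const (-t)) (hmom n).1.ne
  have h2 := ae_lt_top (((measurable_const.sub hmeas).ennreal_ofReal).pow_const (-t)) (hmom n).2.ne
  filter_upwards [h1, h2] with ω h3 h4
  have key : ∀ x : ℝ, ENNReal.ofReal x ^ (-t) < ⊤ → 0 < x := by
    intro x hx
    by_contra! hle
    rw [ENNReal.ofReal_of_nonpos hle, ENNReal.zero_rpow_of_neg (by linarith)] at hx
    exact lt_irrefl _ hx
  exact ⟨key _ h3, sub_pos.1 (key _ h4)⟩

lemma measurable_triple (h : IsRandomMoranModel P A B a b p) (n : ℕ) :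
    Measurable fun ω => ((a n ω, b n ω), p n ω) :=
  ((h.measurable_a n).prodMk (h.measurable_b n)).prodMk (h.measurable_p n)

lemma measurable_levelExcess (h : IsRandomMoranModel P A B a b p) (θ : ℝ) (n : ℕ) :
    Measurable (levelExcess a b p θ n) :=
  (measurable_excess θ).comp (h.measurable_triple n)

lemma iIndepFun_levelExcess (h : IsRandomMoranModel P A B a b p) (θ : ℝ) :
    iIndepFun (levelExcess a b p θ) P :=
  (iIndepFun_prodMk (fun i => (h.measurable_a i).prodMk (h.measurable_b i)) h.measurable_p
    h.indep_ab h.indep_p h.indep_ab_p).comp _ fun _ => measurable_excess θ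

lemma Zval_mem_Icc (h : IsRandomMoranModel P A B a b p) (θ : ℝ) (ω : Ω) :
    Zval θ (a 0 ω) (b 0 ω) (p 0 ω) ∈ Icc (Real.log A) (Real.log B) := by
  have hr := h.isRatioPair ω
  have h1 := hr.branchRatio_le 0 false
  have h2 := hr.branchRatio_le 0 true
  unfold Zval
  split_ifs
  · exact ⟨Real.log_le_log h.A_pos (hr.le_a 0), Real.log_le_log (hr.a_pos 0) h1⟩
  · exact ⟨Real.log_le_log h.A_pos (hr.le_b 0), Real.log_le_log (hr.b_pos 0) h2⟩

variable [IsProbabilityMeasure P]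

lemma identDistrib_levelExcess (h : IsRandomMoranModel P A B a b p) (θ : ℝ) (n : ℕ) :
    IdentDistrib (levelExcess a b p θ n) (levelExcess a b p θ 0) P P := by
  have hind : ∀ n, IndepFun (fun ω => (a n ω, b n ω)) (p n) P := fun n =>
    h.indep_ab_p.comp (measurable_pi_apply n) (measurable_pi_apply n)
  exact ((h.ident_ab n).prodMk (h.ident_p n) (hind n) (hind 0)).comp (measurable_excess θ)

/-- With `X` the excess and `q`, `c` the chosen weight and ratio, `exp X = c ^ θ / q`. Hence `exp (t
* X) ≤ q ^ (-t)`, controlled by the two moments, while `exp (-X) ≤ A ^ (-θ)` is bounded. Convexity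
gives the whole interval `[-1, t]`. -/
lemma zero_mem_interior_integrableExpSet (h : IsRandomMoranModel P A B a b p) {θ : ℝ}
    (hθ : 0 ≤ θ) : 0 ∈ interior (integrableExpSet (levelExcess a b p θ 0) P) := by
  obtain ⟨t, ht, hmom⟩ := h.moment_p
  have hX := h.measurable_levelExcess θ 0
  have hp : Measurable fun ω => (p 0 ω : ℝ) := (h.measurable_p 0).subtype_val
  have hA1 : A < 1 := h.A_lt_B.trans h.B_lt_one
  -- the value of the excess in terms of the best child
  have hval : ∀ᵐ ω ∂P, ∃ q c : ℝ, 0 < q ∧ q ≤ 1 ∧ A ≤ c ∧ c ≤ 1 ∧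
      (q = p 0 ω ∨ q = 1 - p 0 ω) ∧
      levelExcess a b p θ 0 ω = θ * Real.log c - Real.log q := by
    filter_upwards [h.ae_mem_Ioo] with ω hω
    have hq := hω 0
    have hr := h.isRatioPair ω
    have hle : ∀ c, branchRatio (a 0 ω) (b 0 ω) c ≤ 1 := fun c =>
      (hr.branchRatio_le 0 c).trans h.B_lt_one.le
    by_cases hc : (p 0 ω : ℝ) ≤ a 0 ω ^ θ / (a 0 ω ^ θ + b 0 ω ^ θ)
    · refine ⟨p 0 ω, a 0 ω, hq.1, hq.2.le, hr.le_a 0, hle false, Or.inl rfl, ?_⟩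
      simp [levelExcess, excess, Zval, Yval, hc]
    · refine ⟨1 - p 0 ω, b 0 ω, by linarith [hq.2], by linarith [hq.1], hr.le_b 0, hle true,
        Or.inr rfl, ?_⟩
      simp only [levelExcess, excess, Zval, Yval, hc, if_false]
  have hpos : t ∈ integrableExpSet (levelExcess a b p θ 0) P := by
    have hfin : ∫⁻ ω, (ENNReal.ofReal (p 0 ω : ℝ) ^ (-t) +
        ENNReal.ofReal (1 - (p 0 ω : ℝ)) ^ (-t)) ∂P < ⊤ := by
      rw [lintegral_add_left (hp.ennreal_ofReal.pow_const _)]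
      exact ENNReal.add_lt_top.2 (hmom 0)
    refine ⟨(hX.const_mul t).exp.aestronglyMeasurable, lt_of_le_of_lt (lintegral_mono_ae ?_) hfin⟩
    filter_upwards [hval] with ω ⟨q, c, hq0, hq1, hc0, hc1, hq, hXω⟩
    have hc : 0 < c := h.A_pos.trans_le hc0
    have hlog : Real.log c ≤ 0 := Real.log_nonpos hc.le hc1
    have hle : Real.exp (t * levelExcess a b p θ 0 ω) ≤ q ^ (-t) := by
      rw [hXω, Real.rpow_def_of_pos hq0]
      refine Real.exp_le_exp.2 ?_
      nlinarith [mul_nonneg ht.le (mul_nonneg hθ (neg_nonneg.2 hlog))]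
    rw [Real.enorm_eq_ofReal (Real.exp_pos _).le]
    calc ENNReal.ofReal (Real.exp (t * levelExcess a b p θ 0 ω))
        ≤ ENNReal.ofReal (q ^ (-t)) := ENNReal.ofReal_le_ofReal hle
      _ = ENNReal.ofReal q ^ (-t) := (ENNReal.ofReal_rpow_of_pos hq0).symm
      _ ≤ _ := by
        rcases hq with rfl | rfl
        · exact le_self_add
        · exact le_add_self
  have hneg : (-1 : ℝ) ∈ integrableExpSet (levelExcess a b p θ 0) P := by
    refine Integrable.of_bound (hX.const_mul _).exp.aestronglyMeasurable
      (Real.exp (-(θ * Real.log A))) ?_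
    filter_upwards [hval] with ω ⟨q, c, hq0, hq1, hc0, hc1, hq, hXω⟩
    rw [Real.norm_of_nonneg (Real.exp_pos _).le, hXω]
    refine Real.exp_le_exp.2 ?_
    have h1 := Real.log_le_log h.A_pos hc0
    have h2 := Real.log_nonpos hq0.le hq1
    nlinarith
  refine interior_mono (convex_integrableExpSet.ordConnected.out hneg hpos) ?_
  rw [interior_Icc]
  exact ⟨by norm_num, ht⟩

lemma integrable_levelExcess (h : IsRandomMoranModel P A B a b p) {θ : ℝ} (hθ : 0 ≤ θ) :
    Integrable (levelExcess a b p θ 0) P :=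
  integrable_of_mem_interior_integrableExpSet (h.zero_mem_interior_integrableExpSet hθ)

lemma integrable_Zval (h : IsRandomMoranModel P A B a b p) (θ : ℝ) :
    Integrable (fun ω => Zval θ (a 0 ω) (b 0 ω) (p 0 ω)) P := by
  have hp : Measurable fun ω => (p 0 ω : ℝ) := (h.measurable_p 0).subtype_val
  have ha := h.measurable_a 0
  have hb := h.measurable_b 0
  have hset : MeasurableSet {ω | (p 0 ω : ℝ) ≤ a 0 ω ^ θ / (a 0 ω ^ θ + b 0 ω ^ θ)} :=
    measurableSet_le hp ((ha.pow_const θ).div ((ha.pow_const θ).add (hb.pow_const θ)))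
  have hm : Measurable fun ω => Zval θ (a 0 ω) (b 0 ω) (p 0 ω) :=
    Measurable.ite hset ha.log hb.log
  exact Integrable.of_mem_Icc _ _ hm.aemeasurable (ae_of_all _ (h.Zval_mem_Icc θ))

lemma integral_Zval_neg (h : IsRandomMoranModel P A B a b p) (θ : ℝ) :
    ∫ ω, Zval θ (a 0 ω) (b 0 ω) (p 0 ω) ∂P < 0 := by
  have h1 := integral_mono (h.integrable_Zval θ) (integrable_const (Real.log B))
    fun ω => (h.Zval_mem_Icc θ ω).2
  have h2 := Real.log_neg (h.A_pos.trans h.A_lt_B) h.B_lt_one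
  simp only [integral_const, probReal_univ, smul_eq_mul, one_mul] at h1
  linarith

lemma integral_levelExcess (h : IsRandomMoranModel P A B a b p) {θ : ℝ} (hθ : 0 ≤ θ) :
    ∫ ω, levelExcess a b p θ 0 ω ∂P =
      (θ - G P a b p θ) * ∫ ω, Zval θ (a 0 ω) (b 0 ω) (p 0 ω) ∂P := by
  have hZ := h.integrable_Zval θ
  have hZ0 := (h.integral_Zval_neg θ).ne
  have hY : Integrable (fun ω => Yval θ (a 0 ω) (b 0 ω) (p 0 ω)) P := by
    -- `Y` is recovered as `θ * Z - excess`, both terms being integrable.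
    refine ((hZ.const_mul θ).sub (h.integrable_levelExcess hθ)).congr (ae_of_all _ fun ω => ?_)
    simp [levelExcess, excess]
  simp only [levelExcess, excess]
  rw [integral_sub (hZ.const_mul θ) hY, integral_const_mul, G, sub_mul, div_mul_cancel₀ _ hZ0]

/-- For `θ` with `G θ < θ`, the excesses have nonpositive sums over all long windows. -/
lemma ae_sum_excess_window_nonpos (h : IsRandomMoranModel P A B a b p) {θ : ℝ} (hθ : 0 ≤ θ)
    (hG : G P a b p θ < θ) :
    ∃ τ : ℝ, 0 < τ ∧ τ < 1 ∧ ∀ᵐ ω ∂P, ∃ n₀ : ℕ, ∀ n, n₀ ≤ n → ∀ N : ℕ, (N : ℝ) * τ ^ n ≤ 1 →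
      ∑ i ∈ Finset.range n, levelExcess a b p θ (N + i) ω ≤ 0 := by
  refine ae_sum_window_nonpos (h.measurable_levelExcess θ) (h.iIndepFun_levelExcess θ)
    (h.identDistrib_levelExcess θ) (h.zero_mem_interior_integrableExpSet hθ) ?_
  rw [h.integral_levelExcess hθ]
  exact mul_neg_of_pos_of_neg (by linarith) (h.integral_Zval_neg θ)

/-- For a fixed point `θ` of `G`, the means of the excesses tend to zero. -/
lemma ae_tendsto_mean_excess (h : IsRandomMoranModel P A B a b p) {θ : ℝ} (hθ : 0 ≤ θ)
    (hG : G P a b p θ = θ) :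
    ∀ᵐ ω ∂P, Tendsto (fun n : ℕ => (∑ i ∈ Finset.range n, levelExcess a b p θ i ω) / n)
      atTop (𝓝 0) := by
  have h1 := strong_law_ae_real (levelExcess a b p θ) (h.integrable_levelExcess hθ)
    (fun i j hij => (h.iIndepFun_levelExcess θ).indepFun hij) (h.identDistrib_levelExcess θ)
  rwa [h.integral_levelExcess hθ, hG, sub_self, zero_mul] at h1

end IsRandomMoranModel

end RandomMoran

end

/-! ### Assembly of the almost sure statement -/

theorem mainTheorem5 {Ω : Type*} [MeasurableSpace Ω] (P : Measure Ω) [IsProbabilityMeasure P]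
    (A B : ℝ) (a b : ℕ → Ω → ℝ) (p : ℕ → Ω → unitInterval)
    (hmodel : RandomMoran.IsRandomMoranModel P A B a b p)
    (α : ℝ) (hα : 0 ≤ α) (hGα : RandomMoran.G P a b p α = α)
    (hG : ∀ ψ : ℝ, α < ψ → RandomMoran.G P a b p ψ < ψ) :
    ∃ Γ : Set Ω, MeasurableSet Γ ∧ P Γ = 1 ∧
      ∀ Φ : ℝ → ℝ, RandomMoran.IsDimensionFunction Φ → RandomMoran.IsLarge Φ →
        ∀ ω ∈ Γ,
          RandomMoran.upperPhiDim Φ (RandomMoran.randomMoranMeasure a b p ω) = (α : EReal) := by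
  have hwin := fun k : ℕ => hmodel.ae_sum_excess_window_nonpos
    (θ := α + 1 / ((k : ℝ) + 1)) (by positivity) (hG _ (lt_add_of_pos_right α (by positivity)))
  choose τ hτ0 hτ1 hτ using hwin
  have hall : ∀ᵐ ω ∂P, ∀ Φ : ℝ → ℝ, RandomMoran.IsDimensionFunction Φ → RandomMoran.IsLarge Φ →
      RandomMoran.upperPhiDim Φ (RandomMoran.randomMoranMeasure a b p ω) = (α : EReal) := by
    filter_upwards [hmodel.ae_mem_Ioo, hmodel.ae_tendsto_mean_excess hα hGα, ae_all_iff.2 hτ]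
      with ω hp hlow hup Φ hΦ hlarge
    have hr := hmodel.isRatioPair ω
    refine RandomMoran.upperPhiDim_eq
      (fun d hd => hr.le_of_mem_upperExponents hp hlow hΦ hd) fun k => ?_
    obtain ⟨n₀, hn₀⟩ := hup k
    exact hr.mem_upperExponents hp (by positivity) (hτ0 k) (hτ1 k) hn₀ hlarge
  -- The good event quantifies over uncountably many `Φ` and need not be measurable, so `Γ` is the
  -- complement of a measurable null set containing the bad event.
  obtain ⟨s, hs, hsm, hs0⟩ := exists_measurable_superset_of_null (mem_ae_iff.1 hall)
  refine ⟨sᶜ, hsm.compl, (prob_compl_eq_one_iff hsm).2 hs0, fun Φ hΦ hlarge ω hω => ?_⟩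
  exact (not_not.1 fun hn => hω (hs hn) : ω ∈ _) Φ hΦ hlarge
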